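/- The balance game on a finite simple graph $G$ is played by Admirable and Impish, who alternately select a not yet labeled vertex of $G$ until all vertices are labeled; Admirable labels the vertices that she selects by $0$, Impish labels the vertices that he selects by $1$. An edge is labeled by the sum modulo $2$ of the labels of its two ends. Let $e_0$ and $e_1$ be the final numbers of edges labeled $0$ and $1$, and let $d = e_1 - e_0$. Admirable wants to minimize $d$ and Impish wants to maximize $d$. Let $b^A_g(G)$ be the value of $d$ when Admirable makes the first move and both players play optimally. Theorem. For every $n \ge 1$, the path $P_n$ on $n$ vertices satisfies $$2\left\lfloor \frac{n}{16}\right\rfloor + 1 \;\le\; b^A_g(P_n) \;\le\; 4\left\lceil \frac{n}{16}\right\rceil + 5 \quad\text{if } n \text{ is even},$$ $$2\left\lfloor \frac{n}{16}\right\rfloor - 4 \;\le\; b^A_g(P_n) \;\le\; 4\left\lceil \frac{n}{16}\right\rceil \quad\text{if } n \text{ is odd}.$$ -/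

import Mathlib

/-- The two players: Admirable labels the vertices she selects by `0`,
Impish labels the vertices he selects by `1`. -/
inductive BalancePlayer where
  | admirable
  | impish

namespace BalanceGame

variable {V : Type*} [Fintype V] [DecidableEq V] (G : SimpleGraph V) [DecidableRel G.Adj]

/-- The number of edges with one end in `S₀` (labelled `0`) and the other one in `S₁`
(labelled `1`). These are the edges whose label, the sum of the labels of the ends
modulo `2`, is `1`. -/
def e₁ (S₀ S₁ : Finset V) : ℕ :=
  (G.edgeFinset.filter fun e => (∃ u ∈ e, u ∈ S₀) ∧ (∃ v ∈ e, v ∈ S₁)).card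

/-- The number of edges with both ends in `S₀` or both ends in `S₁`, that is, the edges
with label `0`. -/
def e₀ (S₀ S₁ : Finset V) : ℕ :=
  (G.edgeFinset.filter fun e => (∀ u ∈ e, u ∈ S₀) ∨ (∀ u ∈ e, u ∈ S₁)).card

/-- The discrepancy `d = e₁ - e₀` of the state `(S₀, S₁)`. -/
def score (S₀ S₁ : Finset V) : ℤ :=
  (e₁ G S₀ S₁ : ℤ) - (e₀ G S₀ S₁ : ℤ)

/-- The vertices that are not yet labelled in the state `(S₀, S₁)`. -/
def unlabelled (S₀ S₁ : Finset V) : Finset V :=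
  Finset.univ \ (S₀ ∪ S₁)

theorem card_unlabelled_insert_left {S₀ S₁ : Finset V} {v : V} (hv : v ∈ unlabelled S₀ S₁) :
    (unlabelled (insert v S₀) S₁).card < (unlabelled S₀ S₁).card := by
  apply Finset.card_lt_card
  rw [Finset.ssubset_iff_of_subset (fun x hx => by simp_all [unlabelled])]
  exact ⟨v, hv, by simp [unlabelled]⟩

theorem card_unlabelled_insert_right {S₀ S₁ : Finset V} {v : V} (hv : v ∈ unlabelled S₀ S₁) :
    (unlabelled S₀ (insert v S₁)).card < (unlabelled S₀ S₁).card := by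
  apply Finset.card_lt_card
  rw [Finset.ssubset_iff_of_subset (fun x hx => by simp_all [unlabelled])]
  exact ⟨v, hv, by simp [unlabelled]⟩

/-- The value of the final discrepancy when the game is continued from the state `(S₀, S₁)`,
the given player is the next one to move, and both players play optimally:
Admirable selects an unlabelled vertex (which joins `S₀`) so as to minimize the outcome,
Impish selects an unlabelled vertex (which joins `S₁`) so as to maximize it, the players
alternate, and the game ends when all the vertices are labelled. -/
def value (p : BalancePlayer) (S₀ S₁ : Finset V) : ℤ :=
  if h : (unlabelled S₀ S₁).attach.Nonempty then
    match p with
    | .admirable =>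
        (unlabelled S₀ S₁).attach.inf' h fun v => value .impish (insert v.1 S₀) S₁
    | .impish =>
        (unlabelled S₀ S₁).attach.sup' h fun v => value .admirable S₀ (insert v.1 S₁)
  else score G S₀ S₁
termination_by (unlabelled S₀ S₁).card
decreasing_by
  · exact card_unlabelled_insert_left v.2
  · exact card_unlabelled_insert_right v.2

/-- The (A)-start game balance number `b^A_g(G)`. -/
def admirableStart : ℤ :=
  value G .admirable ∅ ∅

end BalanceGame

/-- Adjacency in the path on the vertices `0, 1, …, n - 1` is decidable. -/
instance pathGraphDecidableAdj (n : ℕ) : DecidableRel (SimpleGraph.pathGraph n).Adj :=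
  fun _ _ => decidable_of_iff' _ SimpleGraph.pathGraph_adj

/-! Both bounds come from strategies for the player who moves second on an even number of vertices.
Such a player can cut the path into blocks of even length and always answer in the block just played
(`Wins.union`). The block guarantees then add up, and each edge joining two blocks costs at most 1
(`runPay_add_ge`).

Impish, who replies from the start, secures 1 on two vertices and 3 on sixteen. A block of sixteen
therefore gains 2 after paying for its joining edge, and a block of two gains 0. Admirable opens at
an end of the path and then replies on the rest. She loses at most 3 on every even block of at most
sixteen vertices, hence at most 4 per block of sixteen with its joining edge. A leftover vertex of
the wrong parity costs one more edge: the replier ignores it, and an extra move never hurts her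
(`Wins.take`, `Wins.add_vertex`).

The block guarantees are finite facts, certified by tables. During play a path falls into runs of
unlabelled vertices, and only the lengths of the runs and the labels next to them matter (`Good`).
Each table entry is checked by finding, for every move of the opponent, a reply after which the
position splits into even parts whose known guarantees suffice (`Table.entryOK`). A round removes
two vertices, so induction on their number makes the table sound (`Table.good_of_mem`). -/

namespace BalanceGame

/-! ### The game from the point of view of the player who replies -/

section Wins

variable {α : Type*} [DecidableEq α]

/-- `Wins P U`: the vertices of `U` are selected alternately, the opponent moves first, and the
replying player can make sure that the set of the vertices she selects satisfies `P`. -/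
inductive Wins : (Finset α → Prop) → Finset α → Prop
  | empty {P : Finset α → Prop} : P ∅ → Wins P ∅
  -- With an odd number of vertices the opponent also makes the last move.
  | single {P : Finset α → Prop} (z : α) : P ∅ → Wins P {z}
  | step {P : Finset α → Prop} {U : Finset α} (f : α → α) : U.Nonempty →
      (∀ x ∈ U, f x ∈ U.erase x) →
      (∀ x ∈ U, Wins (fun T => P (insert (f x) T)) ((U.erase x).erase (f x))) → Wins P U

theorem Wins.of_replies {P : Finset α → Prop} {U : Finset α} (hU : U.Nonempty)
    (h : ∀ x ∈ U, ∃ y ∈ U.erase x, Wins (fun T => P (insert y T)) ((U.erase x).erase y)) :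
    Wins P U := by
  choose! f hf h using h
  exact .step f hU hf h

theorem Wins.replies {P : Finset α → Prop} {U : Finset α} (h : Wins P U) (hU : Even U.card) :
    ∀ x ∈ U, ∃ y ∈ U.erase x, Wins (fun T => P (insert y T)) ((U.erase x).erase y) := by
  cases h with
  | empty => simp
  | single z => simp at hU
  | step f _ h₁ h₂ => exact fun x hx => ⟨f x, h₁ x hx, h₂ x hx⟩

theorem Wins.apply_empty {P : Finset α → Prop} (h : Wins P ∅) : P ∅ := by
  generalize hU : (∅ : Finset α) = U at h
  cases h with
  | empty h => rwa [← hU]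
  | single z h => simp at hU
  | step f hne => exact absurd hU.symm hne.ne_empty

theorem Wins.mono {P Q : Finset α → Prop} {U : Finset α} (h : Wins P U)
    (hPQ : ∀ T ⊆ U, P T → Q T) : Wins Q U := by
  induction h generalizing Q with
  | empty h => exact .empty (hPQ _ (by simp) h)
  | single z h => exact .single z (hPQ _ (by simp) h)
  | step f hU hf _ ih =>
    refine .step f hU hf fun x hx => ih x hx fun T hT h => hPQ _ ?_ h
    have := Finset.mem_of_mem_erase (hf x hx)
    exact Finset.insert_subset this
      (hT.trans ((Finset.erase_subset _ _).trans (Finset.erase_subset _ _)))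

theorem card_erase_erase {U : Finset α} {x y : α} (hx : x ∈ U) (hy : y ∈ U.erase x) :
    ((U.erase x).erase y).card + 2 = U.card := by
  have h₁ := Finset.card_erase_add_one hx
  have h₂ := Finset.card_erase_add_one hy
  omega

theorem even_card_erase_erase {U : Finset α} {x y : α} (hx : x ∈ U) (hy : y ∈ U.erase x)
    (hU : Even U.card) : Even ((U.erase x).erase y).card := by
  rw [← card_erase_erase hx hy] at hU
  simpa [Nat.even_add] using hU

theorem Wins.of_forall {P : Finset α → Prop} (U : Finset α) (hP : ∀ T, P T) : Wins P U := by
  induction hn : U.card using Nat.strong_induction_on generalizing U P with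
  | _ n ih =>
    obtain rfl | hU := U.eq_empty_or_nonempty
    · exact .empty (hP _)
    by_cases h1 : ∃ z, U = {z}
    · obtain ⟨z, rfl⟩ := h1
      exact .single z (hP _)
    refine .of_replies hU fun x hx => ?_
    have hne : (U.erase x).Nonempty := by
      rw [Finset.nonempty_iff_ne_empty, Ne, Finset.erase_eq_empty_iff]
      rintro (h | h)
      · exact hU.ne_empty h
      · exact h1 ⟨x, h⟩
    obtain ⟨y, hy⟩ := hne
    have := card_erase_erase hx hy
    exact ⟨y, hy, ih _ (by omega) _ (fun T => hP _) rfl⟩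

/-- Guarantees in two disjoint parts of even size add up: reply in the part in which the opponent
has moved. -/
theorem Wins.union {P Q R : Finset α → Prop} {U V : Finset α} (hU : Wins P U) (hV : Wins Q V)
    (hUe : Even U.card) (hVe : Even V.card) (hd : Disjoint U V)
    (hR : ∀ T ⊆ U, ∀ S ⊆ V, P T → Q S → R (T ∪ S)) : Wins R (U ∪ V) := by
  induction hn : U.card + V.card using Nat.strong_induction_on generalizing P Q R U V with
  | _ n ih =>
    obtain h0 | hne := (U ∪ V).eq_empty_or_nonempty
    · obtain ⟨rfl, rfl⟩ := Finset.union_eq_empty.1 h0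
      exact .empty (hR ∅ (by simp) ∅ (by simp) hU.apply_empty hV.apply_empty)
    refine .of_replies hne fun x hx => ?_
    obtain hx | hx := Finset.mem_union.1 hx
    -- Evenness of the part guarantees that it still contains a reply.
    · obtain ⟨y, hy, h⟩ := hU.replies hUe x hx
      have hyU := Finset.mem_of_mem_erase hy
      have hxV := Finset.disjoint_left.1 hd hx
      have hyV := Finset.disjoint_left.1 hd hyU
      have hc := card_erase_erase hx hy
      have hs : (U.erase x).erase y ⊆ U :=
        (Finset.erase_subset _ _).trans (Finset.erase_subset _ _)
      refine ⟨y, by simp at hy ⊢; tauto, ?_⟩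
      rw [Finset.erase_union_distrib, Finset.erase_union_distrib, Finset.erase_eq_of_notMem hxV,
        Finset.erase_eq_of_notMem hyV]
      refine ih _ (by omega) h hV (even_card_erase_erase hx hy hUe) hVe (hd.mono_left hs)
        (fun T hT S hS hP hQ => ?_) rfl
      rw [← Finset.insert_union]
      exact hR _ (Finset.insert_subset hyU (hT.trans hs)) S hS hP hQ
    · obtain ⟨y, hy, h⟩ := hV.replies hVe x hx
      have hyV := Finset.mem_of_mem_erase hy
      have hxU := Finset.disjoint_right.1 hd hx
      have hyU := Finset.disjoint_right.1 hd hyV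
      have hc := card_erase_erase hx hy
      have hs : (V.erase x).erase y ⊆ V :=
        (Finset.erase_subset _ _).trans (Finset.erase_subset _ _)
      refine ⟨y, by simp at hy ⊢; tauto, ?_⟩
      rw [Finset.erase_union_distrib, Finset.erase_union_distrib, Finset.erase_eq_of_notMem hxU,
        Finset.erase_eq_of_notMem hyU]
      refine ih _ (by omega) hU h hUe (even_card_erase_erase hx hy hVe) (hd.mono_right hs)
        (fun T hT S hS hP hQ => ?_) rfl
      rw [← Finset.union_insert]
      exact hR T hT _ (Finset.insert_subset hyV (hS.trans hs)) hP hQ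

/-- An additional move does not harm. -/
theorem Wins.take {P : Finset α → Prop} {U : Finset α} (h : Wins P U) (hU : Even U.card) {y : α}
    (hy : y ∈ U) : Wins (fun T => P (insert y T)) (U.erase y) := by
  induction hn : U.card using Nat.strong_induction_on generalizing P U y with
  | _ n ih =>
    have hc := Finset.card_erase_add_one hy
    by_cases h1 : ∃ x, U.erase y = {x}
    · obtain ⟨x, hx⟩ := h1
      have hxy : x ∈ U.erase y := by simp [hx]
      obtain ⟨w, hw, h⟩ := h.replies hU x (Finset.mem_of_mem_erase hxy)
      -- Only `x` and `y` were left, so the strategy would have answered `x` by `y`, which she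
      -- already has.
      obtain rfl : w = y := by
        by_contra hne
        have : w ∈ U.erase y := by simp at hw ⊢; tauto
        simp_all
      rw [Finset.erase_right_comm, hx, Finset.erase_singleton] at h
      rw [hx]
      exact .single x h.apply_empty
    refine .of_replies (Finset.card_pos.1 ?_) fun x hx => ?_
    · obtain ⟨k, hk⟩ := hU
      omega
    obtain ⟨w, hw, h⟩ := h.replies hU x (Finset.mem_of_mem_erase hx)
    have hc' := card_erase_erase (Finset.mem_of_mem_erase hx) hw
    have he := even_card_erase_erase (Finset.mem_of_mem_erase hx) hw hU
    -- If the strategy asks for the vertex `y` she already owns, she takes any other vertex, which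
    -- becomes the new extra one.
    by_cases hwy : w = y
    · subst hwy
      have hne : ((U.erase x).erase w).Nonempty := by
        rw [Finset.erase_right_comm, Finset.nonempty_iff_ne_empty, Ne, Finset.erase_eq_empty_iff]
        rintro (h | h)
        · simp [h] at hx
        · exact h1 ⟨x, h⟩
      obtain ⟨y', hy'⟩ := hne
      refine ⟨y', by rwa [Finset.erase_right_comm], ?_⟩
      rw [Finset.erase_right_comm (a := w)]
      exact ih _ (by omega) h he hy' rfl
    · have hyw : y ∈ (U.erase x).erase w := by simp at hx ⊢; tauto
      refine ⟨w, by simp at hw ⊢; tauto, ?_⟩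
      rw [Finset.erase_right_comm (a := y), Finset.erase_right_comm (a := y)]
      simpa only [Finset.insert_comm y w] using ih _ (by omega) h he hyw rfl

/-- A further vertex that the replying player never has to select. -/
theorem Wins.add_vertex {P : Finset α → Prop} {U : Finset α} (h : Wins P U) (hU : Even U.card) {z : α}
    (hz : z ∉ U) : Wins P (insert z U) := by
  induction hn : U.card using Nat.strong_induction_on generalizing P U with
  | _ n ih =>
    obtain rfl | hne := U.eq_empty_or_nonempty
    · exact .single z h.apply_empty
    refine .of_replies (Finset.insert_nonempty _ _) fun x hx => ?_
    -- An opponent who selects `z` hands the replier a free move, harmless by `Wins.take`.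
    obtain rfl | hx := Finset.mem_insert.1 hx
    · obtain ⟨y, hy⟩ := hne
      rw [Finset.erase_insert hz]
      exact ⟨y, hy, h.take hU hy⟩
    · obtain ⟨y, hy, h⟩ := h.replies hU x hx
      have hzx : z ≠ x := fun h => hz (h ▸ hx)
      have hzy : z ≠ y := fun h => hz (h ▸ Finset.mem_of_mem_erase hy)
      have hc := card_erase_erase hx hy
      refine ⟨y, by simp at hy ⊢; tauto, ?_⟩
      rw [Finset.erase_insert_of_ne hzx, Finset.erase_insert_of_ne hzy]
      exact ih _ (by omega) h (even_card_erase_erase hx hy hU) (by simp [hz]) rfl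

end Wins

/-! ### Positions on a path

A run of unlabelled vertices of a path is described by its length and the labels of the two
vertices next to it, where `1` stands for the replying player, `0` for her opponent, and `2` for
the absence of a neighbour. -/

/-- The payoff of an edge for the replying player, who gets `σ` for an edge with two labels. -/
def edgePay (σ : ℤ) (l r : ℕ) : ℤ := if l = 2 ∨ r = 2 then 0 else if l = r then -σ else σ

/-- The label of `v` if the replying player selects the vertices of `T`. -/
def label (T : Finset ℕ) (v : ℕ) : ℕ := if v ∈ T then 1 else 0

/-- The payoff of the edges that meet the run `a, …, a + m - 1` between labels `l` and `r`. -/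
def runPay (σ : ℤ) (T : Finset ℕ) : ℕ → ℕ → ℕ → ℕ → ℤ
  | l, r, _, 0 => edgePay σ l r
  | l, r, a, m + 1 => edgePay σ l (label T a) + runPay σ T (label T a) r (a + 1) m

theorem edgePay_comm (σ : ℤ) (l r : ℕ) : edgePay σ l r = edgePay σ r l := by
  unfold edgePay
  grind

theorem label_le_one (T : Finset ℕ) (v : ℕ) : label T v ≤ 1 := by
  unfold label
  split <;> omega

theorem runPay_congr {σ : ℤ} {S T : Finset ℕ} {a m : ℕ} (l r : ℕ)
    (h : ∀ v, a ≤ v → v < a + m → (v ∈ S ↔ v ∈ T)) :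
    runPay σ S l r a m = runPay σ T l r a m := by
  induction m generalizing l a with
  | zero => rfl
  | succ m ih =>
    have ha : label S a = label T a := by simp [label, h a le_rfl (by omega)]
    rw [runPay, runPay, ha, ih _ fun v h₁ h₂ => h v (by omega) (by omega)]

theorem runPay_cut (σ : ℤ) (T : Finset ℕ) (l r a j k : ℕ) :
    runPay σ T l r a (j + 1 + k) =
      runPay σ T l (label T (a + j)) a j + runPay σ T (label T (a + j)) r (a + j + 1) k := by
  induction j generalizing l a with
  | zero => simp [Nat.add_comm 1 k, runPay]
  | succ j ih =>
    rw [show j + 1 + 1 + k = (j + 1 + k) + 1 by omega, runPay, ih, runPay]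
    simp [Nat.add_comm 1 j, add_assoc]

theorem neg_one_le_edgePay {σ : ℤ} (hσ : |σ| = 1) (l r : ℕ) : -1 ≤ edgePay σ l r := by
  have := abs_le.1 hσ.le
  unfold edgePay
  split_ifs <;> omega

/-- The number of edges that have an end at a label `l`. -/
def stub (l : ℕ) : ℤ := if l = 2 then 0 else 1

/-- Every edge pays at least -1, and the left side counts the edges: `m - 1` inner ones and one for
each labelled neighbour. An empty run is excluded because its two stubs are the same edge. -/
theorem runPay_ge {σ : ℤ} (hσ : |σ| = 1) (T : Finset ℕ) {l r a m : ℕ} (hm : 0 < m) :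
    -(m - 1 + stub l + stub r) ≤ runPay σ T l r a m := by
  obtain ⟨m, rfl⟩ : ∃ k, m = k + 1 := ⟨m - 1, by omega⟩
  have h1 : ∀ l p, -stub l ≤ edgePay σ l p := fun l p => by
    have := neg_one_le_edgePay hσ l p
    unfold stub
    split_ifs with h
    · simp [edgePay, h]
    · exact this
  clear hm
  induction m generalizing l a with
  | zero =>
    have h2 := h1 r (label T a)
    have h3 := h1 l (label T a)
    rw [edgePay_comm] at h2
    simp only [runPay]
    push_cast
    linarith
  | succ m ih =>
    have h3 := h1 l (label T a)
    have h4 := ih (l := label T a) (a := a + 1)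
    have h5 : stub (label T a) = 1 := by
      have := label_le_one T a
      unfold stub
      split_ifs <;> omega
    rw [runPay]
    rw [h5] at h4
    push_cast at h4 ⊢
    linarith

/-! ### Positions as lists of runs, and their codes -/

structure Run where
  start : ℕ
  len : ℕ
  left : ℕ
  right : ℕ

namespace Run

def cells (s : Run) : Finset ℕ := Finset.Ico s.start (s.start + s.len)

def pay (σ : ℤ) (T : Finset ℕ) (s : Run) : ℤ := runPay σ T s.left s.right s.start s.len

end Run

/-- A run up to reflection and translation, as a number. -/
def runCode (m l r : ℕ) : ℕ := if l ≤ r then 9 * m + 3 * l + r else 9 * m + 3 * r + l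

def codeLen (c : ℕ) : ℕ := c / 9
def codeLo (c : ℕ) : ℕ := c / 3 % 3
def codeHi (c : ℕ) : ℕ := c % 3

def Run.code (s : Run) : ℕ := runCode s.len s.left s.right

theorem runCode_comm (m l r : ℕ) : runCode m l r = runCode m r l := by
  unfold runCode
  split_ifs <;> omega

theorem codeLen_runCode {m l r : ℕ} (hl : l ≤ 2) (hr : r ≤ 2) : codeLen (runCode m l r) = m := by
  unfold codeLen runCode
  split_ifs <;> omega

theorem codeLo_runCode {m l r : ℕ} (hl : l ≤ 2) (hr : r ≤ 2) (h : l ≤ r) :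
    codeLo (runCode m l r) = l := by
  unfold codeLo runCode
  rw [if_pos h]
  omega

theorem codeHi_runCode {m l r : ℕ} (hr : r ≤ 2) (h : l ≤ r) :
    codeHi (runCode m l r) = r := by
  unfold codeHi runCode
  rw [if_pos h]
  omega

def cells (L : List Run) : Finset ℕ := L.foldr (fun s U => s.cells ∪ U) ∅

def pay (σ : ℤ) (L : List Run) (T : Finset ℕ) : ℤ := (L.map (Run.pay σ T)).sum

@[simp] theorem cells_nil : cells [] = ∅ := rfl
@[simp] theorem cells_cons (s : Run) (L : List Run) : cells (s :: L) = s.cells ∪ cells L := rfl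
@[simp] theorem pay_nil (σ : ℤ) (T : Finset ℕ) : pay σ [] T = 0 := rfl
@[simp] theorem pay_cons (σ : ℤ) (s : Run) (L : List Run) (T : Finset ℕ) :
    pay σ (s :: L) T = s.pay σ T + pay σ L T := by simp [pay]

@[simp] theorem pay_append (σ : ℤ) (L M : List Run) (T : Finset ℕ) :
    pay σ (L ++ M) T = pay σ L T + pay σ M T := by simp [pay]

theorem mem_cells {L : List Run} {v : ℕ} : v ∈ cells L ↔ ∃ s ∈ L, v ∈ s.cells := by
  induction L with
  | nil => simp
  | cons s L ih => simp [ih]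

@[simp] theorem cells_append (L M : List Run) : cells (L ++ M) = cells L ∪ cells M := by
  ext v
  simp only [Finset.mem_union, mem_cells, List.mem_append]
  grind

theorem cells_perm {L M : List Run} (h : L.Perm M) : cells L = cells M := by
  ext v
  simp [mem_cells, h.mem_iff]

theorem pay_perm {σ : ℤ} {L M : List Run} (h : L.Perm M) (T : Finset ℕ) :
    pay σ L T = pay σ M T := (h.map _).sum_eq

theorem pay_congr {σ : ℤ} {L : List Run} {S T : Finset ℕ}
    (h : ∀ v ∈ cells L, (v ∈ S ↔ v ∈ T)) : pay σ L S = pay σ L T := by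
  induction L with
  | nil => rfl
  | cons s L ih =>
    rw [pay_cons, pay_cons, ih fun v hv => h v (by simp [hv])]
    congr 1
    exact runPay_congr _ _ fun v h₁ h₂ => h v (by simp [Run.cells, h₁, h₂])

/-- Each run carries the labels of its neighbours, so payoffs of different runs interact only
through shared cells. Disjointness is enough, and the runs need not fit together on one path. -/
structure Admissible (L : List Run) : Prop where
  left_le : ∀ s ∈ L, s.left ≤ 2
  right_le : ∀ s ∈ L, s.right ≤ 2
  disjoint : L.Pairwise fun s t => Disjoint s.cells t.cells

theorem Admissible.perm {L M : List Run} (h : Admissible L) (hp : L.Perm M) : Admissible M where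
  left_le s hs := h.left_le s (hp.mem_iff.2 hs)
  right_le s hs := h.right_le s (hp.mem_iff.2 hs)
  disjoint := (hp.pairwise_iff fun h => h.symm).1 h.disjoint

theorem Admissible.sublist {L M : List Run} (h : Admissible L) (hs : M.Sublist L) :
    Admissible M where
  left_le s h' := h.left_le s (hs.mem h')
  right_le s h' := h.right_le s (hs.mem h')
  disjoint := h.disjoint.sublist hs

theorem Admissible.disjoint_cells_append {L M : List Run} (h : Admissible (L ++ M)) :
    Disjoint (cells L) (cells M) := by
  rw [Finset.disjoint_left]
  intro v h₁ h₂
  obtain ⟨s, hs, h₁⟩ := mem_cells.1 h₁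
  obtain ⟨t, ht, h₂⟩ := mem_cells.1 h₂
  exact Finset.disjoint_left.1 ((List.pairwise_append.1 h.disjoint).2.2 s hs t ht) h₁ h₂

def totalLen (g : List ℕ) : ℕ := (g.map codeLen).sum

theorem totalLen_perm {g g' : List ℕ} (h : g.Perm g') : totalLen g = totalLen g' :=
  (h.map _).sum_eq

@[simp] theorem totalLen_append (g g' : List ℕ) :
    totalLen (g ++ g') = totalLen g + totalLen g' := by simp [totalLen]

@[simp] theorem totalLen_cons (c : ℕ) (g : List ℕ) :
    totalLen (c :: g) = codeLen c + totalLen g := by simp [totalLen]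

@[simp] theorem totalLen_nil : totalLen [] = 0 := rfl

theorem Admissible.card_cells {L : List Run} (h : Admissible L) :
    (cells L).card = totalLen (L.map Run.code) := by
  induction L with
  | nil => rfl
  | cons s L ih =>
    have hd := h.disjoint_cells_append (L := [s]) (M := L)
    simp only [cells_cons, cells_nil, Finset.union_empty] at hd
    rw [cells_cons, Finset.card_union_of_disjoint hd,
      ih (h.sublist (List.sublist_cons_self s L)), List.map_cons, totalLen_cons, Run.code,
      codeLen_runCode (h.left_le s (by simp)) (h.right_le s (by simp))]
    simp [Run.cells]

/-! ### Guarantees that depend only on the codes -/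

/-- `Good σ g t`: in every position with runs `g` the replying player gets at least `t`. -/
def Good (σ : ℤ) (g : List ℕ) (t : ℤ) : Prop :=
  ∀ L : List Run, Admissible L → (L.map Run.code).Perm g →
    Wins (fun T => t ≤ pay σ L T) (cells L)

theorem Good.perm {σ : ℤ} {g g' : List ℕ} {t : ℤ} (h : Good σ g t) (hp : g.Perm g') :
    Good σ g' t := fun L hL hg => h L hL (hg.trans hp.symm)

theorem Good.mono {σ : ℤ} {g : List ℕ} {t t' : ℤ} (h : Good σ g t) (ht : t' ≤ t) :
    Good σ g t' := fun L hL hg => (h L hL hg).mono fun _ _ => ht.trans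

theorem good_nil {σ : ℤ} {t : ℤ} (ht : t ≤ 0) : Good σ [] t := by
  rintro L - hg
  obtain rfl : L = [] := by simpa using hg.length_eq
  exact .empty (by simpa using ht)

theorem exists_perm_append {L : List Run} {g g' : List ℕ}
    (h : (L.map Run.code).Perm (g ++ g')) :
    ∃ M N : List Run, L.Perm (M ++ N) ∧ (M.map Run.code).Perm g ∧ (N.map Run.code).Perm g' := by
  induction g generalizing L with
  | nil => exact ⟨[], L, by simp, by simp, by simpa using h⟩
  | cons c g ih =>
    have hc : c ∈ L.map Run.code := h.mem_iff.2 (by simp)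
    obtain ⟨s, hs, rfl⟩ := List.mem_map.1 hc
    obtain ⟨K, hK⟩ : ∃ K, L.Perm (s :: K) := by
      obtain ⟨A, B, rfl⟩ := List.append_of_mem hs
      exact ⟨A ++ B, List.perm_middle⟩
    obtain ⟨M, N, h₁, h₂, h₃⟩ := ih ((((hK.map Run.code).symm.trans h)).cons_inv)
    exact ⟨s :: M, N, hK.trans (h₁.cons s), by simpa using h₂.cons s.code, h₃⟩

theorem exists_perm_cons {L : List Run} {c : ℕ} {g : List ℕ}
    (h : (L.map Run.code).Perm (c :: g)) :
    ∃ s K, L.Perm (s :: K) ∧ s.code = c ∧ (K.map Run.code).Perm g := by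
  obtain ⟨M, N, h₁, h₂, h₃⟩ := exists_perm_append (g := [c]) h
  obtain ⟨s, rfl⟩ : ∃ s, M = [s] := List.length_eq_one_iff.1 (by simpa using h₂.length_eq)
  exact ⟨s, N, h₁, by simpa using h₂, h₃⟩

theorem Good.append {σ : ℤ} {g g' : List ℕ} {t t' : ℤ} (h : Good σ g t) (h' : Good σ g' t')
    (hg : Even (totalLen g)) (hg' : Even (totalLen g')) : Good σ (g ++ g') (t + t') := by
  intro L hL hp
  obtain ⟨M, N, h₁, h₂, h₃⟩ := exists_perm_append hp
  have hA := hL.perm h₁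
  have hM := hA.sublist (List.sublist_append_left M N)
  have hN := hA.sublist (List.sublist_append_right M N)
  have hd := hA.disjoint_cells_append
  rw [cells_perm h₁, cells_append]
  refine (h M hM h₂).union (h' N hN h₃) (by rwa [hM.card_cells, totalLen_perm h₂])
    (by rwa [hN.card_cells, totalLen_perm h₃]) hd fun T hT S hS h₄ h₅ => ?_
  rw [pay_perm h₁, pay_append]
  refine add_le_add (h₄.trans_eq (pay_congr fun v hv => ?_)) (h₅.trans_eq (pay_congr fun v hv => ?_))
  · have : v ∉ S := fun h => Finset.disjoint_left.1 hd hv (hS h)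
    simp [this]
  · have : v ∉ T := fun h => Finset.disjoint_right.1 hd hv (hT h)
    simp [this]

/-- The number of edges that meet a run. -/
def codeEdges (c : ℕ) : ℤ :=
  codeLen c + 1 - (if codeLo c = 2 then 1 else 0) - (if codeHi c = 2 then 1 else 0)

theorem codeEdges_code {s : Run} (hl : s.left ≤ 2) (hr : s.right ≤ 2) :
    codeEdges s.code = s.len - 1 + stub s.left + stub s.right := by
  unfold codeEdges Run.code
  obtain h | h := le_total s.left s.right
  · rw [codeLen_runCode hl hr, codeLo_runCode hl hr h, codeHi_runCode hr h]
    unfold stub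
    split_ifs <;> ring
  · rw [runCode_comm, codeLen_runCode hr hl, codeLo_runCode hr hl h, codeHi_runCode hl h]
    unfold stub
    split_ifs <;> ring

theorem good_neg_edges {σ : ℤ} (hσ : |σ| = 1) {g : List ℕ} (hg : ∀ c ∈ g, 0 < codeLen c) :
    Good σ g (-(g.map codeEdges).sum) := by
  intro L hL hp
  refine .of_forall _ fun T => ?_
  rw [← (hp.map codeEdges).sum_eq]
  have hg : ∀ s ∈ L, 0 < codeLen s.code := fun s hs =>
    hg _ (hp.mem_iff.1 (by simpa using ⟨s, hs, rfl⟩))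
  clear hp
  induction L with
  | nil => simp
  | cons s L ih =>
    have hl := hL.left_le s (by simp)
    have hr := hL.right_le s (by simp)
    have h₁ := ih (hL.sublist (List.sublist_cons_self s L)) fun t ht => hg t (by simp [ht])
    have h₂ := hg s (by simp)
    rw [Run.code, codeLen_runCode hl hr] at h₂
    have h₃ := runPay_ge hσ T (l := s.left) (r := s.right) (a := s.start) h₂
    have h₄ := codeEdges_code hl hr
    simp only [List.map_cons, List.sum_cons, pay_cons, Run.pay]
    linarith

/-- An empty run is an edge whose payoff is already settled, so it can be cashed in. -/
theorem Good.cons_empty {σ : ℤ} {g : List ℕ} {t : ℤ} {l r : ℕ} (hl : l ≤ 2) (hr : r ≤ 2)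
    (h : Good σ g (t - edgePay σ l r)) : Good σ (runCode 0 l r :: g) t := by
  intro L hL hp
  obtain ⟨s, K, h₁, h₂, h₃⟩ := exists_perm_cons hp
  have hA := hL.perm h₁
  have hsl := hA.left_le s (by simp)
  have hsr := hA.right_le s (by simp)
  have h0 : s.len = 0 := by
    have := codeLen_runCode (m := 0) hl hr
    rwa [← h₂, Run.code, codeLen_runCode hsl hsr] at this
  have he : s.pay σ = fun _ => edgePay σ l r := by
    have h₄ : s.left = l ∧ s.right = r ∨ s.left = r ∧ s.right = l := by
      rw [Run.code, h0] at h₂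
      unfold runCode at h₂
      split_ifs at h₂ <;> omega
    ext T
    rw [Run.pay, h0, runPay]
    obtain ⟨h₅, h₆⟩ | ⟨h₅, h₆⟩ := h₄
    · rw [h₅, h₆]
    · rw [h₅, h₆, edgePay_comm]
  have hc : cells L = cells K := by
    rw [cells_perm h₁, cells_cons]
    simp [Run.cells, h0]
  rw [hc]
  refine (h K (hA.sublist (List.sublist_cons_self s K)) h₃).mono fun T _ h => ?_
  rw [pay_perm h₁, pay_cons, congrFun he T]
  linarith

/-! ### Moves on runs and on codes -/

/-- `L'` arises from `L` by giving the vertex `v` the label `p`. -/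
structure IsMove (σ : ℤ) (p v : ℕ) (L L' : List Run) : Prop where
  mem : v ∈ cells L
  admissible : Admissible L'
  cells_eq : cells L' = (cells L).erase v
  pay_eq : ∀ T, label T v = p → pay σ L T = pay σ L' T

theorem IsMove.of_perm {σ : ℤ} {p v : ℕ} {L M L' : List Run} (h : IsMove σ p v M L')
    (hp : L.Perm M) : IsMove σ p v L L' where
  mem := cells_perm hp ▸ h.mem
  admissible := h.admissible
  cells_eq := by rw [cells_perm hp, h.cells_eq]
  pay_eq T hT := by rw [pay_perm hp, h.pay_eq T hT]

/-- The runs that a run `c` leaves when its vertex number `j` gets the label `p`. -/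
def pieces (p c j : ℕ) : List ℕ :=
  [runCode j (codeLo c) p, runCode (codeLen c - 1 - j) p (codeHi c)]

theorem isMove_cut {σ : ℤ} {s : Run} {K : List Run} (h : Admissible (s :: K)) {i p : ℕ}
    (hi : i < s.len) (hp : p ≤ 2) :
    IsMove σ p (s.start + i) (s :: K)
      (⟨s.start, i, s.left, p⟩ :: ⟨s.start + i + 1, s.len - 1 - i, p, s.right⟩ :: K) where
  mem := by simp [Run.cells, hi]
  admissible := by
    have hd := List.pairwise_cons.1 h.disjoint
    refine ⟨?_, ?_, ?_⟩
    · simpa using ⟨h.left_le s (by simp), hp, fun t ht => h.left_le t (by simp [ht])⟩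
    · simpa using ⟨hp, h.right_le s (by simp), fun t ht => h.right_le t (by simp [ht])⟩
    · simp only [List.pairwise_cons, List.mem_cons, forall_eq_or_imp]
      refine ⟨⟨?_, fun t ht => (hd.1 t ht).mono_left ?_⟩, fun t ht => (hd.1 t ht).mono_left ?_, hd.2⟩
      · rw [Finset.disjoint_left]
        simp [Run.cells]
        omega
      · exact Finset.Ico_subset_Ico le_rfl (by simp; omega)
      · exact Finset.Ico_subset_Ico (by simp; omega) (by simp; omega)
  cells_eq := by
    have hd := List.pairwise_cons.1 h.disjoint
    have hv : s.start + i ∉ cells K := fun hv => by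
      obtain ⟨t, ht, hv⟩ := mem_cells.1 hv
      exact Finset.disjoint_left.1 (hd.1 t ht) (by simp [Run.cells, hi]) hv
    ext v
    simp only [cells_cons, Run.cells, Finset.mem_union, Finset.mem_Ico, Finset.mem_erase]
    by_cases hvK : v ∈ cells K
    · have : v ≠ s.start + i := fun h => hv (h ▸ hvK)
      simp [hvK, this]
    · simp only [hvK, or_false]
      omega
  pay_eq T hT := by
    have := runPay_cut σ T s.left s.right s.start i (s.len - 1 - i)
    rw [show i + 1 + (s.len - 1 - i) = s.len by omega, hT] at this
    simp only [pay_cons, Run.pay, this]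
    ring

theorem pieces_code {s : Run} (hl : s.left ≤ 2) (hr : s.right ≤ 2) {i p : ℕ} (hi : i < s.len) :
    -- A code lists the smaller neighbouring label first, so a run with `s.right < s.left` is read
    -- backwards.
    (pieces p s.code (if s.left ≤ s.right then i else s.len - 1 - i)).Perm
      [runCode i s.left p, runCode (s.len - 1 - i) p s.right] := by
  unfold pieces Run.code
  rw [codeLen_runCode hl hr]
  split_ifs with h
  · rw [codeLo_runCode hl hr h, codeHi_runCode hr h]
  · have h := (not_le.1 h).le
    rw [runCode_comm s.len, codeLo_runCode hr hl h, codeHi_runCode hl h,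
      show s.len - 1 - (s.len - 1 - i) = i by omega, runCode_comm _ s.right, runCode_comm i]
    exact List.Perm.swap _ _ _

/-- Realises a reply chosen on codes by an actual vertex; `exists_code_of_mem` is the converse
translation, used for the opponent's moves. -/
theorem exists_isMove {σ : ℤ} {L : List Run} (hL : Admissible L) {c : ℕ} {g : List ℕ}
    (hg : (L.map Run.code).Perm (c :: g)) {j p : ℕ} (hj : j < codeLen c) (hp : p ≤ 2) :
    ∃ v L', IsMove σ p v L L' ∧ (L'.map Run.code).Perm (pieces p c j ++ g) := by
  obtain ⟨s, K, h₁, rfl, h₃⟩ := exists_perm_cons hg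
  have hA := hL.perm h₁
  have hl := hA.left_le s (by simp)
  have hr := hA.right_le s (by simp)
  rw [Run.code, codeLen_runCode hl hr] at hj
  obtain ⟨i, hi, hij⟩ : ∃ i < s.len, (if s.left ≤ s.right then i else s.len - 1 - i) = j := by
    split_ifs
    · exact ⟨j, hj, rfl⟩
    · exact ⟨s.len - 1 - j, by omega, by omega⟩
  have hm := isMove_cut (σ := σ) hA hi hp
  have hpc := (pieces_code hl hr hi (p := p)).symm.append h₃
  rw [hij] at hpc
  exact ⟨_, _, hm.of_perm h₁, hpc⟩

theorem exists_code_of_mem {σ : ℤ} {L : List Run} (hL : Admissible L) {v : ℕ} (hv : v ∈ cells L)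
    {p : ℕ} (hp : p ≤ 2) :
    ∃ c g j L', (L.map Run.code).Perm (c :: g) ∧ j < codeLen c ∧ IsMove σ p v L L' ∧
      (L'.map Run.code).Perm (pieces p c j ++ g) := by
  obtain ⟨s, hs, hv⟩ := mem_cells.1 hv
  obtain ⟨K, h₁⟩ : ∃ K, L.Perm (s :: K) := by
    obtain ⟨A, B, rfl⟩ := List.append_of_mem hs
    exact ⟨A ++ B, List.perm_middle⟩
  have hA := hL.perm h₁
  have hl := hA.left_le s (by simp)
  have hr := hA.right_le s (by simp)
  obtain ⟨i, hi, rfl⟩ : ∃ i < s.len, s.start + i = v := by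
    simp only [Run.cells, Finset.mem_Ico] at hv
    exact ⟨v - s.start, by omega, by omega⟩
  have hm := isMove_cut (σ := σ) hA hi hp
  refine ⟨s.code, K.map Run.code, if s.left ≤ s.right then i else s.len - 1 - i, _, ?_, ?_,
    hm.of_perm h₁, (pieces_code hl hr hi (p := p)).symm.append_right _⟩
  · simpa using h₁.map Run.code
  · rw [Run.code, codeLen_runCode hl hr]
    split_ifs <;> omega

theorem Good.of_replies {σ : ℤ} {g : List ℕ} {t : ℤ} (hg : 0 < totalLen g)
    (h : ∀ c g₁, g.Perm (c :: g₁) → ∀ j < codeLen c, ∃ c' g₂ j',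
      (pieces 0 c j ++ g₁).Perm (c' :: g₂) ∧ j' < codeLen c' ∧ Good σ (pieces 1 c' j' ++ g₂) t) :
    Good σ g t := by
  intro L hL hp
  refine .of_replies (Finset.card_pos.1 (by rwa [hL.card_cells, totalLen_perm hp])) fun x hx => ?_
  obtain ⟨c, g₁, j, L₁, h₁, hj, hm, hp₁⟩ := exists_code_of_mem (σ := σ) hL hx (p := 0) (by omega)
  obtain ⟨c', g₂, j', hp₂, hj', hG⟩ := h c g₁ (hp.symm.trans h₁) j hj
  obtain ⟨y, L₂, hm', hp₃⟩ := exists_isMove (σ := σ) hm.admissible (hp₁.trans hp₂) hj'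
    (p := 1) (by omega)
  have hy : y ∈ (cells L).erase x := hm.cells_eq ▸ hm'.mem
  refine ⟨y, hy, ?_⟩
  rw [← hm.cells_eq, ← hm'.cells_eq]
  refine (hG L₂ hm'.admissible hp₃).mono fun T hT h => ?_
  have hx : x ∉ insert y T := by
    rw [hm'.cells_eq, hm.cells_eq] at hT
    intro hx
    obtain rfl | hx := Finset.mem_insert.1 hx
    · simp at hy
    · simpa using hT hx
  rw [hm.pay_eq _ (by simp [label, hx]), hm'.pay_eq _ (by simp [label])]
  refine h.trans_eq (pay_congr fun v hv => ?_)
  have : v ≠ y := by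
    rintro rfl
    simp [hm'.cells_eq] at hv
  simp [this]

/-! ### Checking a table of guarantees -/

/-- A search tree of positions with guaranteed payoffs. -/
inductive Table where
  | e : Table
  | n : Table → List ℕ → ℤ → Table → Table

def Table.entries : Table → List (List ℕ × ℤ)
  | .e => []
  | .n a g t b => a.entries ++ (g, t) :: b.entries

def key (g : List ℕ) : ℕ := g.foldr (fun c k => c + 256 * k) 0

def Table.find (q : ℕ) (g : List ℕ) : Table → Option ℤ
  | .e => none
  | .n a h t b => if h == g then some t else if key h ≤ q then b.find q g else a.find q g

/-- Passing a number through `force` makes the kernel evaluate it first. -/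
def force {α : Type} (n : ℕ) (k : ℕ → α) : α :=
  match n with
  | 0 => k 0
  | m + 1 => k (m + 1)

@[simp] theorem force_eq {α : Type} (n : ℕ) (k : ℕ → α) : force n k = k n := by
  cases n <;> rfl

/-- A guarantee for the whole of `g`: the one in the table or the trivial one. -/
def Table.worth (T : Table) (g : List ℕ) : Option ℤ :=
  if totalLen g % 2 = 0 then
    match force (key g) fun q => T.find q g with
    | some t => some t
    | none => some (-(g.map codeEdges).sum)
  else none

/-- Does a splitting of the list into two parts satisfy `k`? -/
def anySplit : List ℕ → (List ℕ → List ℕ → Bool) → Bool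
  | [], k => k [] []
  | c :: cs, k => anySplit cs (fun a b => k (c :: a) b) || anySplit cs (fun a b => k a (c :: b))

/-- Is there a partition of the position whose parts have guarantees that add up to `t`? -/
def Table.covers (T : Table) : ℕ → List ℕ → ℤ → Bool
  -- The fuel must exceed the number of parts used.
  | 0, _, _ => false
  | _ + 1, [], t => decide (t ≤ 0)
  | f + 1, c :: cs, t => anySplit cs fun a b =>
      match T.worth (c :: a) with
      | some v => T.covers f b (t - v)
      | none => false

def sortedInsert (c : ℕ) : List ℕ → List ℕ
  | [] => [c]
  | d :: ds => if c ≤ d then c :: d :: ds else d :: sortedInsert c ds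

/-- Add a run to a position from which `t` is wanted. -/
def push (σ : ℤ) (m l r : ℕ) (k : List ℕ → ℤ → Bool) (g : List ℕ) (t : ℤ) : Bool :=
  if m = 0 then k g (t - edgePay σ l r)
  else force (runCode m l r) fun c => k (sortedInsert c g) t

/-- Add what remains of the run `c` when its vertex number `j` gets the label `p`. -/
def cut (σ : ℤ) (p c j : ℕ) (k : List ℕ → ℤ → Bool) (g : List ℕ) (t : ℤ) : Bool :=
  push σ j (codeLo c) p (push σ (codeLen c - 1 - j) p (codeHi c) k) g t

/-- A code is at least 9 exactly when its run is nonempty. Entries may appeal to the whole table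
without circularity, since a round leaves two vertices fewer. -/
def Table.entryOK (T : Table) (σ : ℤ) (g : List ℕ) (t : ℤ) : Bool :=
  g.all (fun c => decide (9 ≤ c)) && (decide (0 < totalLen g) &&
  g.all fun c => (List.range (codeLen c)).all fun j =>
    cut σ 0 c j (fun g' t' => g'.any fun c' => (List.range (codeLen c')).any fun j' =>
      cut σ 1 c' j' (T.covers 8) (g'.erase c') t') (g.erase c) t)

def Table.OK (T : Table) (σ : ℤ) : Bool := T.entries.all fun x => T.entryOK σ x.1 x.2

/-- A hit compares the whole list, so soundness requires neither a correctly ordered tree nor an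
injective `key`. -/
theorem Table.mem_of_find {q : ℕ} {g : List ℕ} {t : ℤ} {T : Table} (h : T.find q g = some t) :
    (g, t) ∈ T.entries := by
  induction T with
  | e => simp [Table.find] at h
  | n a x v b iha ihb =>
    unfold Table.find at h
    split_ifs at h with h₁ h₂
    · simp_all [Table.entries]
    · simp [Table.entries, ihb h]
    · simp [Table.entries, iha h]

theorem exists_of_anySplit {l : List ℕ} {k : List ℕ → List ℕ → Bool} (h : anySplit l k = true) :
    ∃ a b, (a ++ b).Perm l ∧ k a b = true := by
  induction l generalizing k with
  | nil => exact ⟨[], [], by simp, h⟩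
  | cons c l ih =>
    obtain h | h := Bool.or_eq_true_iff.1 h
    · obtain ⟨a, b, h₁, h₂⟩ := ih h
      exact ⟨c :: a, b, h₁.cons c, h₂⟩
    · obtain ⟨a, b, h₁, h₂⟩ := ih h
      exact ⟨a, c :: b, List.perm_middle.trans (h₁.cons c), h₂⟩

theorem sortedInsert_perm (c : ℕ) (l : List ℕ) : (sortedInsert c l).Perm (c :: l) := by
  induction l with
  | nil => exact .refl _
  | cons d l ih =>
    unfold sortedInsert
    split_ifs
    · exact .refl _
    · exact (ih.cons d).trans (.swap _ _ _)

/-- Guarantees of the table hold for positions with at most `N` unlabelled vertices. -/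
def Table.Sound (T : Table) (σ : ℤ) (N : ℕ) : Prop :=
  ∀ x ∈ T.entries, totalLen x.1 ≤ N → Good σ x.1 x.2

theorem Table.good_of_worth {T : Table} {σ : ℤ} (hσ : |σ| = 1) {N : ℕ} (hT : T.Sound σ N)
    {g : List ℕ} (hN : totalLen g ≤ N) (hg : ∀ c ∈ g, 0 < codeLen c) {v : ℤ}
    (h : T.worth g = some v) : Even (totalLen g) ∧ Good σ g v := by
  unfold Table.worth at h
  split_ifs at h with he
  refine ⟨Nat.even_iff.2 he, ?_⟩
  rw [force_eq] at h
  split at h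
  · rename_i t ht
    obtain rfl : t = v := by simpa using h
    exact hT _ (Table.mem_of_find ht) hN
  · obtain rfl := Option.some.inj h
    exact good_neg_edges hσ hg

theorem Table.good_of_covers {T : Table} {σ : ℤ} (hσ : |σ| = 1) {N : ℕ} (hT : T.Sound σ N)
    {f : ℕ} {g : List ℕ} (hN : totalLen g ≤ N) (hg : ∀ c ∈ g, 0 < codeLen c) {t : ℤ}
    (h : T.covers f g t = true) : Even (totalLen g) ∧ Good σ g t := by
  induction f generalizing g t with
  | zero => simp [Table.covers] at h
  | succ f ih =>
    cases g with
    | nil => exact ⟨by simp, good_nil (by simpa [Table.covers] using h)⟩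
    | cons c cs =>
      unfold Table.covers at h
      obtain ⟨a, b, hp, h⟩ := exists_of_anySplit h
      have hp' : ((c :: a) ++ b).Perm (c :: cs) := hp.cons c
      have ht := totalLen_perm hp'
      rw [totalLen_append] at ht
      have hm : ∀ x ∈ (c :: a) ++ b, 0 < codeLen x := fun x hx => hg x (hp'.mem_iff.1 hx)
      split at h
      · rename_i v hv
        obtain ⟨h₁, h₂⟩ := Table.good_of_worth hσ hT (by omega)
          (fun x hx => hm x (List.mem_append_left _ hx)) hv
        obtain ⟨h₃, h₄⟩ := ih (by omega) (fun x hx => hm x (List.mem_append_right _ hx)) h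
        refine ⟨ht ▸ h₁.add h₃, ?_⟩
        have := (h₂.append h₄ h₁ h₃).perm hp'
        rwa [add_sub_cancel] at this
      · simp at h

/-- Dropping the runs `E`, all of them empty, changes a payoff from `t` to `t'`. -/
def Drops (σ : ℤ) (E : List ℕ) (t t' : ℤ) : Prop := ∀ Y, Good σ Y t' → Good σ (Y ++ E) t

/-- Recovers the position and target handed to the continuation, with the empty runs `E` already
cashed in. -/
theorem exists_of_push {σ : ℤ} {m l r : ℕ} (hl : l ≤ 2) (hr : r ≤ 2) {k : List ℕ → ℤ → Bool}
    {g : List ℕ} {t : ℤ} (hg : ∀ c ∈ g, 0 < codeLen c) (h : push σ m l r k g t = true) :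
    ∃ g' t' E, k g' t' = true ∧ (∀ c ∈ g', 0 < codeLen c) ∧
      (g' ++ E).Perm (runCode m l r :: g) ∧ Drops σ E t t' := by
  unfold push at h
  split_ifs at h with hm
  · subst hm
    refine ⟨g, _, [runCode 0 l r], h, hg, List.perm_append_comm, fun Y hY => ?_⟩
    exact (Good.cons_empty hl hr hY).perm (List.perm_append_comm (l₁ := [_]))
  · rw [force_eq] at h
    have hp := sortedInsert_perm (runCode m l r) g
    refine ⟨_, t, [], h, fun c hc => ?_, by simpa using hp, fun Y hY => by simpa using hY⟩
    obtain rfl | hc := List.mem_cons.1 (hp.mem_iff.1 hc)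
    · rw [codeLen_runCode hl hr]
      omega
    · exact hg c hc

theorem codeLo_le (c : ℕ) : codeLo c ≤ 2 := by
  unfold codeLo
  omega

theorem codeHi_le (c : ℕ) : codeHi c ≤ 2 := by
  unfold codeHi
  omega

theorem exists_of_cut {σ : ℤ} {p c j : ℕ} (hp : p ≤ 2) {k : List ℕ → ℤ → Bool}
    {g : List ℕ} {t : ℤ} (hg : ∀ c ∈ g, 0 < codeLen c) (h : cut σ p c j k g t = true) :
    ∃ g' t' E, k g' t' = true ∧ (∀ c ∈ g', 0 < codeLen c) ∧
      (g' ++ E).Perm (pieces p c j ++ g) ∧ Drops σ E t t' := by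
  obtain ⟨g₁, t₁, E₁, h, hg₁, hp₁, hd₁⟩ := exists_of_push (codeLo_le c) hp hg h
  obtain ⟨g₂, t₂, E₂, h, hg₂, hp₂, hd₂⟩ := exists_of_push hp (codeHi_le c) hg₁ h
  refine ⟨g₂, t₂, E₂ ++ E₁, h, hg₂, ?_, fun Y hY => ?_⟩
  · rw [← List.append_assoc]
    refine (hp₂.append_right E₁).trans ((hp₁.cons _).trans (.swap _ _ _))
  · rw [← List.append_assoc]
    exact hd₁ _ (hd₂ _ hY)

theorem totalLen_pieces {p c j : ℕ} (hp : p ≤ 2) (hj : j < codeLen c) :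
    totalLen (pieces p c j) + 1 = codeLen c := by
  simp only [pieces, totalLen_cons, totalLen_nil, codeLen_runCode (codeLo_le c) hp,
    codeLen_runCode hp (codeHi_le c)]
  omega

theorem Table.good_of_entryOK {T : Table} {σ : ℤ} (hσ : |σ| = 1) {N : ℕ} (hT : T.Sound σ N)
    {g : List ℕ} {t : ℤ} (hN : totalLen g ≤ N + 1) (h : T.entryOK σ g t = true) :
    Good σ g t := by
  simp only [Table.entryOK, Bool.and_eq_true, List.all_eq_true, decide_eq_true_eq,
    List.mem_range] at h
  obtain ⟨hg, h0, h⟩ := h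
  have hg : ∀ c ∈ g, 0 < codeLen c := fun c hc => by
    have := hg c hc
    unfold codeLen
    omega
  refine Good.of_replies h0 fun c g₀ hc j hj => ?_
  have hcg : c ∈ g := hc.mem_iff.2 (by simp)
  have hce := List.perm_cons_erase hcg
  have hg₀ : (g.erase c).Perm g₀ := (hce.symm.trans hc).cons_inv
  obtain ⟨g₁, t₁, E₁, h₁, hg₁, hp₁, hd₁⟩ := exists_of_cut (by omega)
    (fun x hx => hg x (List.mem_of_mem_erase hx)) (h c hcg j hj)
  simp only [List.any_eq_true, List.mem_range] at h₁
  obtain ⟨c', hc', j', hj', h₁⟩ := h₁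
  have hce' := List.perm_cons_erase hc'
  obtain ⟨g₂, t₂, E₂, h₂, hg₂, hp₂, hd₂⟩ := exists_of_cut (by omega)
    (fun x hx => hg₁ x (List.mem_of_mem_erase hx)) h₁
  -- The true position still contains the empty runs `E₁` that the checker has dropped.
  refine ⟨c', g₁.erase c' ++ E₁, j', ?_, hj', ?_⟩
  · exact (hg₀.symm.append_left _).trans (hp₁.symm.trans (hce'.append_right _))
  have hlen : totalLen g₂ ≤ N := by
    have e₁ := totalLen_perm hce
    have e₂ := totalLen_perm hp₁
    have e₃ := totalLen_perm hce'
    have e₄ := totalLen_perm hp₂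
    have e₅ := totalLen_pieces (p := 0) (by omega) hj
    have e₆ := totalLen_pieces (p := 1) (by omega) hj'
    simp only [totalLen_append, totalLen_cons] at e₁ e₂ e₃ e₄
    omega
  have hG := (Table.good_of_covers hσ hT hlen hg₂ h₂).2
  rw [← List.append_assoc]
  exact hd₁ _ ((hd₂ _ hG).perm hp₂)

theorem Table.good_of_mem {T : Table} {σ : ℤ} (hσ : |σ| = 1) (hT : T.OK σ = true) {g : List ℕ}
    {t : ℤ} (h : (g, t) ∈ T.entries) : Good σ g t := by
  have hT : ∀ x ∈ T.entries, T.entryOK σ x.1 x.2 = true := List.all_eq_true.1 hT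
  have hS : ∀ N, T.Sound σ N := by
    intro N
    induction N with
    | zero =>
      intro x hx h0
      have := hT x hx
      simp only [Table.entryOK, Bool.and_eq_true, decide_eq_true_eq] at this
      omega
    | succ N ih => exact fun x hx hN => Table.good_of_entryOK hσ ih hN (hT x hx)
  exact hS _ _ h le_rfl

/-! ### The two tables and their verification -/

/-- Positions that Admirable, replying to Impish, holds to the recorded payoff. -/
def admirableTable : Table :=
  .n (.n (.n (.n (.n (.n (.n (.n .e [18] (-1) .e) [22] (-1) .e) [36] (-3) (.n .e [37] (-1) .e))
  [38] (-2) (.n (.n (.n .e [41] (-2) .e) [54] (-1) .e) [55] (-3) (.n .e [56] (-2) .e))) [58] (-1)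
  (.n (.n (.n (.n .e [59] (-2) .e) [62] (-3) .e) [72] (-3) (.n .e [80] (-3) .e)) [98] (-3) (.n (.n
  (.n .e [116] (-3) .e) [127] (-3) .e) [134] (-3) (.n .e [152] (-3) .e)))) [9,9] 0 (.n (.n (.n (.n
  (.n .e [9,10] (-2) .e) [10,10] 0 .e) [9,11] (-1) (.n .e [10,11] (-1) .e)) [11,11] 0 (.n (.n (.n
  .e [10,14] (-1) .e) [14,14] 0 .e) [19,20] (-3) (.n .e [20,20] (-2) .e))) [23,23] (-2) (.n (.n
  (.n (.n .e [10,27] 0 .e) [14,27] (-1) .e) [10,28] (-2) (.n .e [11,28] (-3) .e)) [10,29] (-1) (.n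
  (.n (.n .e [11,29] (-2) .e) [9,31] (-2) .e) [10,31] 0 (.n .e [11,31] (-1) .e))))) [27,31] 0 (.n
  (.n (.n (.n (.n (.n .e [29,31] (-1) .e) [10,32] (-1) .e) [19,36] (-2) (.n .e [23,36] (-3) .e))
  [20,38] (-2) (.n (.n (.n .e [23,38] (-2) .e) [38,38] (-2) .e) [36,40] (-2) (.n .e [19,41] (-3)
  .e))) [20,41] (-2) (.n (.n (.n (.n .e [41,41] (-2) .e) [10,45] (-2) .e) [9,46] (-2) (.n .e
  [14,46] (-3) .e)) [28,46] (-2) (.n (.n (.n .e [29,46] (-3) .e) [45,46] (-2) .e) [13,47] (-3) (.n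
  .e [29,47] (-2) .e)))) [11,50] (-2) (.n (.n (.n (.n (.n .e [32,50] (-2) .e) [19,55] (-2) .e)
  [36,55] (-2) (.n .e [55,55] (-2) .e)) [20,56] (-2) (.n (.n (.n .e [36,56] (-3) .e) [10,64] (-2)
  .e) [47,64] (-3) (.n .e [11,65] (-2) .e))) [10,68] (-3) (.n (.n (.n (.n .e [10,104] (-3) .e)
  [9,10,19] (-1) .e) [9,11,19] (-2) (.n .e [10,11,19] (-2) .e)) [9,14,19] (-2) (.n (.n (.n .e
  [11,14,19] (-1) .e) [19,19,19] (-1) .e) [9,10,20] (-2) (.n .e [9,11,20] (-1) .e)))))) [9,14,20]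
  (-3) (.n (.n (.n (.n (.n (.n (.n .e [10,14,20] (-1) .e) [19,20,20] (-3) .e) [10,11,23] (-1) (.n
  .e [9,14,23] (-3) .e)) [9,19,28] (-3) (.n (.n (.n .e [10,19,28] (-1) .e) [10,20,28] (-2) .e)
  [9,19,29] (-2) (.n .e [11,19,29] (-3) .e))) [9,23,29] (-3) (.n (.n (.n (.n .e [9,19,31] (-1) .e)
  [11,19,32] (-3) .e) [10,23,32] (-1) (.n .e [9,10,36] (-1) .e)) [9,14,36] (-2) (.n (.n (.n .e
  [11,14,36] (-3) .e) [19,19,36] (-1) .e) [20,23,36] (-3) (.n .e [29,32,36] (-3) .e)))) [19,20,38]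
  (-3) (.n (.n (.n (.n (.n .e [9,32,38] (-3) .e) [10,11,40] (-2) .e) [9,14,40] (-2) (.n .e
  [9,10,41] (-2) .e)) [10,14,41] (-1) (.n (.n (.n .e [20,36,41] (-3) .e) [36,38,41] (-3) .e)
  [9,19,45] (-3) (.n .e [11,20,46] (-3) .e))) [29,41,46] (-3) (.n (.n (.n (.n .e [11,19,49] (-4)
  .e) [9,19,50] (-2) .e) [10,20,50] (-3) (.n .e [29,36,50] (-3) .e)) [20,46,50] (-3) (.n (.n (.n
  .e [38,46,50] (-3) .e) [11,29,55] (-3) .e) [14,46,56] (-3) (.n .e [29,46,59] (-3) .e)))))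
  [10,19,64] (-1) (.n (.n (.n (.n (.n (.n .e [11,41,64] (-3) .e) [10,23,65] (-3) .e) [14,36,65]
  (-3) (.n .e [23,46,65] (-3) .e)) [10,19,68] (-2) (.n (.n (.n .e [11,36,68] (-3) .e) [10,38,68]
  (-3) .e) [11,46,77] (-3) (.n .e [10,41,83] (-3) .e))) [10,32,92] (-3) (.n (.n (.n (.n .e
  [10,20,104] (-3) .e) [9,10,19,19] 0 .e) [9,10,19,20] (-1) (.n .e [10,11,19,20] (-2) .e))
  [9,10,19,23] (-1) (.n (.n (.n .e [9,10,20,23] (-2) .e) [9,10,23,23] (-2) .e) [9,11,14,28] (-2)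
  (.n .e [9,19,19,29] (-3) .e)))) [11,19,19,29] (-2) (.n (.n (.n (.n (.n .e [10,19,20,29] (-2) .e)
  [10,19,20,32] (-2) .e) [14,19,29,36] (-2) (.n .e [9,10,23,38] (-2) .e)) [14,19,31,38] (-2) (.n
  (.n (.n .e [10,19,32,38] (-2) .e) [9,10,19,40] 0 .e) [9,10,23,40] (-1) (.n .e [9,19,29,40] (-3)
  .e))) [10,11,19,41] (-2) (.n (.n (.n (.n .e [10,11,28,49] (-3) .e) [10,11,19,56] (-2) .e)
  [10,14,29,64] (-2) (.n .e [9,19,23,65] (-4) .e)) [10,19,20,68] (-2) (.n (.n (.n .e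
  [9,10,11,14,19] (-1) .e) [9,10,19,20,23] (-1) .e) [9,10,11,19,32] (-1) (.n .e [9,10,20,23,40]
  (-1) .e))))))

/-- Positions that Impish, replying to Admirable, holds to the recorded payoff. -/
def impishTable : Table :=
  .n (.n (.n (.n (.n (.n (.n (.n .e [18] 1 .e) [19] (-1) (.n .e [20] 0 .e)) [22] 1 (.n (.n .e [23]
  0 .e) [26] 1 .e)) [36] (-1) (.n (.n (.n .e [37] 1 .e) [38] 0 (.n .e [40] (-1) .e)) [41] 0 (.n
  (.n .e [54] 1 .e) [56] 0 .e))) [58] 1 (.n (.n (.n (.n .e [59] 0 .e) [73] 1 (.n .e [74] 0 .e))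
  [77] 0 (.n (.n .e [90] 1 .e) [92] 0 .e)) [95] 0 (.n (.n (.n .e [109] 1 .e) [112] 3 .e) [113] 2
  (.n (.n .e [131] 2 .e) [152] 3 .e)))) [9,9] 0 (.n (.n (.n (.n (.n .e [10,10] 0 .e) [9,11] (-1)
  (.n .e [10,11] (-1) .e)) [11,11] 0 (.n (.n .e [10,13] (-2) .e) [13,13] 0 .e)) [10,14] (-1) (.n
  (.n (.n .e [13,14] (-1) .e) [14,14] 0 (.n .e [10,27] 0 .e)) [11,27] (-1) (.n (.n .e [13,27] (-2)
  .e) [27,27] 0 .e))) [9,28] 0 (.n (.n (.n (.n .e [11,28] (-1) .e) [13,28] 0 (.n .e [14,28] (-1)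
  .e)) [28,28] 0 (.n (.n .e [9,29] (-1) .e) [10,29] (-1) .e)) [11,29] (-2) (.n (.n (.n .e [13,29]
  (-1) .e) [14,29] 0 .e) [27,29] (-1) (.n (.n .e [28,29] (-1) .e) [29,29] 0 .e))))) [9,32] (-1)
  (.n (.n (.n (.n (.n (.n .e [10,32] (-1) .e) [11,32] 0 (.n .e [27,32] (-1) .e)) [28,32] (-1) (.n
  (.n .e [40,41] 1 .e) [13,45] 0 .e)) [10,46] 0 (.n (.n (.n .e [11,46] (-1) .e) [27,46] 0 (.n .e
  [29,46] (-1) .e)) [46,46] 0 (.n (.n .e [10,47] (-1) .e) [11,47] 0 .e))) [13,47] (-1) (.n (.n (.n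
  (.n .e [9,49] 0 .e) [11,49] (-1) (.n .e [46,49] 2 .e)) [9,50] (-1) (.n (.n .e [10,50] (-1) .e)
  [13,50] (-1) .e)) [27,50] (-1) (.n (.n (.n .e [29,50] 0 .e) [46,50] 1 .e) [49,50] 1 (.n (.n .e
  [41,55] 1 .e) [55,55] 2 .e)))) [59,59] 2 (.n (.n (.n (.n (.n .e [10,63] 0 .e) [11,63] (-1) (.n
  .e [49,63] 2 .e)) [50,63] 1 (.n (.n .e [13,64] 0 .e) [14,64] (-1) .e)) [46,64] 2 (.n (.n (.n .e
  [50,64] 1 .e) [10,65] (-1) .e) [13,65] (-1) (.n (.n .e [50,65] 0 .e) [13,67] 2 .e))) [14,67] 1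
  (.n (.n (.n (.n .e [10,68] (-1) .e) [11,68] 0 (.n .e [13,68] 1 .e)) [50,68] 2 (.n (.n .e [59,74]
  2 .e) [41,77] 2 .e)) [13,81] 0 (.n (.n (.n .e [10,82] 0 .e) [11,82] (-1) .e) [13,82] 2 (.n (.n
  .e [14,82] 1 .e) [29,82] 1 .e)))))) [32,82] 1 (.n (.n (.n (.n (.n (.n (.n .e [11,83] 0 .e)
  [13,83] 1 (.n .e [50,83] 2 .e)) [10,85] 2 (.n (.n .e [11,85] 1 .e) [27,85] 2 .e)) [10,86] 1 (.n
  (.n (.n .e [19,91] 2 .e) [41,92] 2 (.n .e [23,95] 2 .e)) [38,95] 2 (.n (.n .e [13,99] 2 .e)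
  [10,104] 1 .e))) [23,110] 2 (.n (.n (.n (.n .e [11,122] 2 .e) [10,13,40] 1 (.n .e [11,13,40] 0
  .e)) [10,14,40] 0 (.n (.n .e [13,14,40] 0 .e) [19,19,40] 1 .e)) [23,23,40] 1 (.n (.n (.n .e
  [13,27,40] 1 .e) [14,27,40] 0 .e) [13,29,40] 0 (.n (.n .e [10,32,40] 0 .e) [27,32,40] 0 .e))))
  [23,38,40] 1 (.n (.n (.n (.n (.n .e [38,38,40] 1 .e) [10,13,41] 0 (.n .e [13,27,41] 0 .e))
  [10,28,41] 0 (.n (.n .e [13,32,41] 1 .e) [13,20,46] 0 .e)) [13,36,46] 1 (.n (.n (.n .e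
  [13,41,47] 1 .e) [28,41,47] 1 .e) [10,19,49] 1 (.n (.n .e [23,29,49] 1 .e) [10,36,49] 1 .e)))
  [10,38,49] 0 (.n (.n (.n (.n .e [29,38,49] 1 .e) [10,19,50] 0 (.n .e [13,23,50] 1 .e))
  [13,36,50] 0 (.n (.n .e [13,38,50] 1 .e) [28,38,50] 1 .e)) [10,41,50] 1 (.n (.n (.n .e
  [27,41,50] 1 .e) [10,13,55] 1 .e) [11,13,55] 0 (.n (.n .e [10,14,55] 0 .e) [13,27,55] 1 .e)))))
  [11,49,56] 1 (.n (.n (.n (.n (.n (.n .e [11,13,59] (-1) .e) [13,14,59] 1 (.n .e [13,27,59] 0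
  .e)) [13,29,59] 1 (.n (.n .e [28,29,59] 1 .e) [10,32,59] 1 .e)) [27,32,59] 1 (.n (.n (.n .e
  [11,46,59] 1 .e) [13,19,63] 1 (.n .e [13,20,63] 0 .e)) [23,32,63] 1 (.n (.n .e [23,29,64] 1 .e)
  [11,41,64] 1 .e))) [13,23,65] 1 (.n (.n (.n (.n .e [23,28,65] 1 .e) [13,38,65] 1 (.n .e
  [10,19,68] 0 .e)) [10,23,68] 1 (.n (.n .e [23,27,68] 1 .e) [10,38,68] 1 .e)) [10,13,72] 1 (.n
  (.n (.n .e [13,29,74] 1 .e) [11,13,77] 1 .e) [10,14,77] 1 (.n (.n .e [10,23,83] 1 .e) [11,13,92]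
  1 .e)))) [10,11,95] 1 (.n (.n (.n (.n (.n .e [10,13,19,19] 0 .e) [10,14,19,19] (-1) (.n .e
  [10,13,23,23] 0 .e)) [19,19,23,23] 0 (.n (.n .e [13,19,19,27] 0 .e) [13,23,23,27] 0 .e))
  [10,19,19,28] 0 (.n (.n (.n .e [10,13,14,32] 0 .e) [10,19,23,32] 0 .e) [19,23,27,32] 0 (.n (.n
  .e [10,13,29,32] 0 .e) [10,13,23,36] (-1) .e))) [13,23,29,36] 0 (.n (.n (.n (.n .e [10,23,32,36]
  0 .e) [13,19,29,38] 0 (.n .e [10,13,38,38] 0 .e)) [10,14,19,41] 0 (.n (.n .e [11,13,36,41] 0 .e)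
  [11,13,29,46] 0 .e)) [10,11,29,49] 0 (.n (.n (.n .e [10,11,13,50] 0 .e) [11,13,27,50] 0 .e)
  [11,13,19,56] 0 (.n (.n .e [10,11,19,59] 0 .e) [10,11,19,19,23] (-1) .e))))))

theorem admirableTable_ok : admirableTable.OK (-1) = true := by decide +kernel

theorem impishTable_ok : impishTable.OK 1 = true := by decide +kernel

theorem Table.good_of_find {T : Table} {σ : ℤ} (hσ : |σ| = 1) (hT : T.OK σ = true) {g : List ℕ}
    {t : ℤ} (h : T.find (key g) g = some t) : Good σ g t :=
  Table.good_of_mem hσ hT (Table.mem_of_find h)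

/-! ### Guarantees on whole paths -/

/-- In the path on `a, …, a + m - 1` the replying player gets at least `t`. -/
def Guarantee (σ : ℤ) (a m : ℕ) (t : ℤ) : Prop :=
  Wins (fun T => t ≤ runPay σ T 2 2 a m) (Finset.Ico a (a + m))

theorem Guarantee.mono {σ : ℤ} {a m : ℕ} {t t' : ℤ} (h : Guarantee σ a m t) (ht : t' ≤ t) :
    Guarantee σ a m t' := Wins.mono h fun _ _ => ht.trans

theorem Good.guarantee {σ : ℤ} {m : ℕ} {t : ℤ} (h : Good σ [runCode m 2 2] t) (a : ℕ) :
    Guarantee σ a m t := by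
  have := h [⟨a, m, 2, 2⟩] ⟨by simp, by simp, by simp⟩ (by simp [Run.code])
  simpa [Run.cells, Run.pay, Guarantee] using this

/-- Separating the halves forgets at most the edge between them, which pays at least -1. -/
theorem runPay_add_ge {σ : ℤ} (hσ : |σ| = 1) (T : Finset ℕ) (l r a m m' : ℕ) :
    runPay σ T l 2 a m + runPay σ T 2 r (a + m) m' - 1 ≤ runPay σ T l r a (m + m') := by
  induction m generalizing l a with
  | zero =>
    cases m' with
    | zero =>
      have := neg_one_le_edgePay hσ l r
      simpa [runPay, edgePay] using this
    | succ k =>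
      have := neg_one_le_edgePay hσ l (label T a)
      rw [Nat.zero_add, Nat.add_zero, runPay, runPay, runPay]
      simp only [edgePay, true_or, or_true, if_true] at this ⊢
      linarith
  | succ m ih =>
    have := ih (label T a) (a + 1)
    rw [show m + 1 + m' = m + m' + 1 by omega, runPay, runPay,
      show a + (m + 1) = a + 1 + m by omega]
    linarith

theorem Guarantee.append {σ : ℤ} (hσ : |σ| = 1) {a m m' : ℕ} {t t' : ℤ} (h : Guarantee σ a m t)
    (h' : Guarantee σ (a + m) m' t') (hm : Even m) (hm' : Even m') :
    Guarantee σ a (m + m') (t + t' - 1) := by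
  have hd : Disjoint (Finset.Ico a (a + m)) (Finset.Ico (a + m) (a + m + m')) :=
    Finset.Ico_disjoint_Ico_consecutive _ _ _
  unfold Guarantee
  rw [← Nat.add_assoc, ← Finset.Ico_union_Ico_eq_Ico (by omega : a ≤ a + m) (by omega)]
  refine Wins.union h h' (by simpa) (by simpa) hd fun T hT S hS h₁ h₂ => ?_
  have e₁ : runPay σ T 2 2 a m = runPay σ (T ∪ S) 2 2 a m := runPay_congr _ _ fun v h₁ h₂ => by
    have : v ∉ S := fun h => by have := Finset.mem_Ico.1 (hS h); omega
    simp [this]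
  have e₂ : runPay σ S 2 2 (a + m) m' = runPay σ (T ∪ S) 2 2 (a + m) m' :=
    runPay_congr _ _ fun v h₁ h₂ => by
      have : v ∉ T := fun h => by have := Finset.mem_Ico.1 (hT h); omega
      simp [this]
  have := runPay_add_ge hσ (T ∪ S) 2 2 a m m'
  linarith

theorem Guarantee.add_vertex {σ : ℤ} (hσ : |σ| = 1) {a m : ℕ} {t : ℤ} (h : Guarantee σ a m t)
    (hm : Even m) : Guarantee σ a (m + 1) (t - 1) := by
  have := Wins.add_vertex h (by simpa) (z := a + m) (by simp)
  unfold Guarantee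
  rw [← Nat.add_assoc, Finset.Ico_add_one_right_eq_Icc, ← Finset.Ico_insert_right (by omega)]
  refine this.mono fun T _ h => ?_
  have := runPay_add_ge hσ T 2 2 a m 1
  have h0 : runPay σ T 2 2 (a + m) 1 = 0 := by simp [runPay, edgePay]
  linarith

theorem guarantee_zero (σ : ℤ) (a : ℕ) : Guarantee σ a 0 0 :=
  .of_forall _ fun T => by simp [runPay, edgePay]

theorem guarantee_impish_two (a : ℕ) : Guarantee 1 a 2 1 :=
  (Table.good_of_find (by simp) impishTable_ok (by decide +kernel)).guarantee a

theorem guarantee_impish_sixteen (a : ℕ) : Guarantee 1 a 16 3 :=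
  (Table.good_of_find (by simp) impishTable_ok (by decide +kernel)).guarantee a

theorem guarantee_admirable_small (a k : ℕ) (hk : k ≤ 8) : Guarantee (-1) a (2 * k) (-3) := by
  -- Two or four vertices span at most three edges, so the trivial bound suffices; lengths 6 to 16
  -- are table entries.
  interval_cases k
  · exact (guarantee_zero _ a).mono (by norm_num)
  · exact ((good_neg_edges (by simp) (by simp [codeLen, runCode])).mono
      (by simp [codeEdges, codeLen, codeLo, codeHi, runCode])).guarantee a
  · exact ((good_neg_edges (by simp) (by simp [codeLen, runCode])).mono
      (by simp [codeEdges, codeLen, codeLo, codeHi, runCode])).guarantee a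
  all_goals
    exact (Table.good_of_find (by simp) admirableTable_ok (by decide +kernel)).guarantee a

theorem guarantee_impish_two_mul (a k : ℕ) : Guarantee 1 a (2 * (k + 1)) 1 := by
  induction k with
  | zero => exact guarantee_impish_two a
  | succ k ih =>
    exact Guarantee.append (by simp) ih (guarantee_impish_two _) (by simp) (by simp)

theorem guarantee_impish (a k : ℕ) : Guarantee 1 a (2 * (k + 1)) (2 * ((k + 1) / 8 : ℕ) + 1) := by
  induction k using Nat.strong_induction_on generalizing a with
  | _ k ih =>
    obtain hk | rfl | hk := lt_trichotomy k 7
    · rw [Nat.div_eq_of_lt (by omega)]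
      exact guarantee_impish_two_mul a k
    · exact guarantee_impish_sixteen a
    -- Splitting off sixteen vertices gains 3 - 1 = 2.
    · have := (guarantee_impish_sixteen a).append (by simp) (ih (k - 8) (by omega) _)
        (by decide) (by simp)
      rw [show 16 + 2 * (k - 8 + 1) = 2 * (k + 1) by omega] at this
      refine this.mono ?_
      rw [show (k + 1) / 8 = (k - 8 + 1) / 8 + 1 by omega]
      push_cast
      linarith

theorem guarantee_admirable (a k : ℕ) : Guarantee (-1) a (2 * k) (-(4 * (k / 8 : ℕ) + 3)) := by
  induction k using Nat.strong_induction_on generalizing a with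
  | _ k ih =>
    obtain hk | hk := lt_or_ge k 8
    · rw [Nat.div_eq_of_lt hk]
      exact guarantee_admirable_small a k hk.le
    -- Splitting off sixteen vertices costs 3 + 1 = 4.
    · have := (guarantee_admirable_small a 8 le_rfl).append (by simp) (ih (k - 8) (by omega) _)
        (by decide) (by simp)
      rw [show 2 * 8 + 2 * (k - 8) = 2 * k by omega] at this
      refine this.mono ?_
      rw [show k / 8 = (k - 8) / 8 + 1 by omega]
      push_cast
      linarith

/-! ### Guarantees bound the value of the game -/

theorem Wins.of_map {α β : Type*} [DecidableEq α] [DecidableEq β] (f : β ↪ α)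
    {P : Finset α → Prop} {U : Finset β} (h : Wins P (U.map f)) :
    Wins (fun T => P (T.map f)) U := by
  generalize hV : U.map f = V at h
  induction h generalizing U with
  | empty h =>
    obtain rfl := Finset.map_eq_empty.1 hV
    exact .empty (by simpa using h)
  | single z h =>
    obtain ⟨x, rfl⟩ : ∃ x, U = {x} := by
      rw [← Finset.card_eq_one, ← Finset.card_map f, hV, Finset.card_singleton]
    exact .single x (by simpa using h)
  | step g hne hg _ ih =>
    subst hV
    refine .of_replies (by simpa using hne) fun x hx => ?_
    have hx' := Finset.mem_map_of_mem f hx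
    have hy := hg _ hx'
    rw [← Finset.map_erase] at hy
    obtain ⟨y, hy, hxy⟩ := Finset.mem_map.1 hy
    refine ⟨y, hy, ?_⟩
    simp only [Finset.map_insert]
    have := ih _ hx' (U := (U.erase x).erase y) (by rw [Finset.map_erase, Finset.map_erase, hxy])
    rwa [← hxy] at this

section Value

variable {V : Type*} [Fintype V] [DecidableEq V] (G : SimpleGraph V) [DecidableRel G.Adj]

theorem unlabelled_insert_left (S₀ S₁ : Finset V) (v : V) :
    unlabelled (insert v S₀) S₁ = (unlabelled S₀ S₁).erase v := by
  ext x
  simp [unlabelled]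

theorem unlabelled_insert_right (S₀ S₁ : Finset V) (v : V) :
    unlabelled S₀ (insert v S₁) = (unlabelled S₀ S₁).erase v := by
  ext x
  simp [unlabelled]

variable {S₀ S₁ : Finset V} {c : ℤ}

theorem value_of_unlabelled_eq_empty (h : unlabelled S₀ S₁ = ∅) (p : BalancePlayer) :
    value G p S₀ S₁ = score G S₀ S₁ := by
  rw [value, dif_neg (by simp [h])]

theorem le_value_admirable (hne : (unlabelled S₀ S₁).Nonempty)
    (h : ∀ v ∈ unlabelled S₀ S₁, c ≤ value G .impish (insert v S₀) S₁) :
    c ≤ value G .admirable S₀ S₁ := by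
  rw [value, dif_pos (Finset.attach_nonempty_iff.2 hne)]
  exact Finset.le_inf' _ _ fun v _ => h v v.2

theorem value_impish_le (hne : (unlabelled S₀ S₁).Nonempty)
    (h : ∀ v ∈ unlabelled S₀ S₁, value G .admirable S₀ (insert v S₁) ≤ c) :
    value G .impish S₀ S₁ ≤ c := by
  rw [value, dif_pos (Finset.attach_nonempty_iff.2 hne)]
  exact Finset.sup'_le _ _ fun v _ => h v v.2

theorem le_value_impish {v : V} (hv : v ∈ unlabelled S₀ S₁)
    (h : c ≤ value G .admirable S₀ (insert v S₁)) : c ≤ value G .impish S₀ S₁ := by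
  rw [value, dif_pos (Finset.attach_nonempty_iff.2 ⟨v, hv⟩)]
  exact h.trans (Finset.le_sup' (fun v : unlabelled S₀ S₁ => value G .admirable S₀ (insert v.1 S₁))
    (Finset.mem_attach _ ⟨v, hv⟩))

theorem value_admirable_le {v : V} (hv : v ∈ unlabelled S₀ S₁)
    (h : value G .impish (insert v S₀) S₁ ≤ c) : value G .admirable S₀ S₁ ≤ c := by
  rw [value, dif_pos (Finset.attach_nonempty_iff.2 ⟨v, hv⟩)]
  exact (Finset.inf'_le (fun v : unlabelled S₀ S₁ => value G .impish (insert v.1 S₀) S₁)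
    (Finset.mem_attach _ ⟨v, hv⟩)).trans h

theorem Wins.le_value {P : Finset V → Prop} {U : Finset V} (h : Wins P U)
    (hU : unlabelled S₀ S₁ = U)
    (hP : ∀ T ⊆ U, P T → c ≤ score G (S₀ ∪ U \ T) (S₁ ∪ T)) :
    c ≤ value G .admirable S₀ S₁ := by
  induction h generalizing S₀ S₁ with
  | empty h =>
    rw [value_of_unlabelled_eq_empty G hU]
    simpa using hP ∅ (by simp) h
  | single z h =>
    refine le_value_admirable G (by simp [hU]) fun v hv => ?_
    obtain rfl : v = z := by simpa [hU] using hv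
    rw [value_of_unlabelled_eq_empty G (by simp [unlabelled_insert_left, hU])]
    simpa [Finset.union_comm S₀, ← Finset.insert_eq] using hP ∅ (by simp) h
  | step f hne hf _ ih =>
    subst hU
    refine le_value_admirable G hne fun x hx => ?_
    have hy := hf x hx
    refine le_value_impish G (v := f x) (by rwa [unlabelled_insert_left]) ?_
    refine ih x hx (by rw [unlabelled_insert_right, unlabelled_insert_left]) fun T hT h => ?_
    have hT' : insert (f x) T ⊆ unlabelled S₀ S₁ :=
      Finset.insert_subset (Finset.mem_of_mem_erase hy)
        (hT.trans ((Finset.erase_subset _ _).trans (Finset.erase_subset _ _)))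
    convert hP _ hT' h using 2
    · have hxT : x ∉ T := fun h => by simpa using hT h
      ext v
      simp only [Finset.mem_union, Finset.mem_insert, Finset.mem_sdiff, Finset.mem_erase] at hy ⊢
      grind
    · rw [Finset.insert_union, Finset.union_insert]

theorem Wins.value_le {P : Finset V → Prop} {U : Finset V} (h : Wins P U)
    (hU : unlabelled S₀ S₁ = U)
    (hP : ∀ T ⊆ U, P T → score G (S₀ ∪ T) (S₁ ∪ U \ T) ≤ c) :
    value G .impish S₀ S₁ ≤ c := by
  induction h generalizing S₀ S₁ with
  | empty h =>
    rw [value_of_unlabelled_eq_empty G hU]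
    simpa using hP ∅ (by simp) h
  | single z h =>
    refine value_impish_le G (by simp [hU]) fun v hv => ?_
    obtain rfl : v = z := by simpa [hU] using hv
    rw [value_of_unlabelled_eq_empty G (by simp [unlabelled_insert_right, hU])]
    simpa [Finset.union_comm S₁, ← Finset.insert_eq] using hP ∅ (by simp) h
  | step f hne hf _ ih =>
    subst hU
    refine value_impish_le G hne fun x hx => ?_
    have hy := hf x hx
    refine value_admirable_le G (v := f x) (by rwa [unlabelled_insert_right]) ?_
    refine ih x hx (by rw [unlabelled_insert_left, unlabelled_insert_right]) fun T hT h => ?_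
    have hT' : insert (f x) T ⊆ unlabelled S₀ S₁ :=
      Finset.insert_subset (Finset.mem_of_mem_erase hy)
        (hT.trans ((Finset.erase_subset _ _).trans (Finset.erase_subset _ _)))
    convert hP _ hT' h using 2
    · rw [Finset.insert_union, Finset.union_insert]
    · have hxT : x ∉ T := fun h => by simpa using hT h
      ext v
      simp only [Finset.mem_union, Finset.mem_insert, Finset.mem_sdiff, Finset.mem_erase] at hy ⊢
      grind

end Value

/-! ### The score on a path -/

theorem edgeFinset_pathGraph (m : ℕ) :
    (SimpleGraph.pathGraph (m + 1)).edgeFinset =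
      (Finset.univ : Finset (Fin m)).image fun i => s(i.castSucc, i.succ) := by
  ext e
  induction e using Sym2.ind with
  | _ u v =>
    simp only [SimpleGraph.mem_edgeFinset, SimpleGraph.mem_edgeSet, SimpleGraph.pathGraph_adj,
      Finset.mem_image, Finset.mem_univ, true_and, Sym2.eq_iff, Fin.ext_iff, Fin.val_castSucc,
      Fin.val_succ]
    constructor
    · rintro (h | h)
      · exact ⟨⟨u, by omega⟩, .inl ⟨rfl, h⟩⟩
      · exact ⟨⟨v, by omega⟩, .inr ⟨rfl, h⟩⟩
    · rintro ⟨i, h | h⟩ <;> omega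

theorem runPay_succ (σ : ℤ) (T : Finset ℕ) (l a m : ℕ) :
    runPay σ T l 2 a (m + 1) = edgePay σ l (label T a) +
      ∑ i ∈ Finset.range m, edgePay σ (label T (a + i)) (label T (a + i + 1)) := by
  induction m generalizing l a with
  | zero => simp [runPay, edgePay]
  | succ m ih =>
    have h : ∀ i, a + 1 + i = a + (i + 1) := fun i => by omega
    rw [runPay, ih, Finset.sum_range_succ', Nat.add_zero, add_comm (∑ i ∈ _, _)]
    simp only [h, Nat.add_zero]

theorem score_pathGraph {m : ℕ} {S₀ S₁ : Finset (Fin (m + 1))} (h : ∀ v, v ∈ S₀ ↔ v ∉ S₁) :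
    score (SimpleGraph.pathGraph (m + 1)) S₀ S₁ =
      ∑ i : Fin m, if (i.castSucc ∈ S₁ ↔ i.succ ∈ S₁) then -1 else 1 := by
  have hinj : Function.Injective fun i : Fin m => s(i.castSucc, i.succ) := fun i j hij => by
    simp only [Sym2.eq_iff, Fin.ext_iff, Fin.val_castSucc, Fin.val_succ] at hij
    omega
  unfold score e₁ e₀
  rw [edgeFinset_pathGraph, Finset.card_filter, Finset.card_filter,
    Finset.sum_image hinj.injOn, Finset.sum_image hinj.injOn]
  push_cast
  rw [← Finset.sum_sub_distrib]
  refine Finset.sum_congr rfl fun i _ => ?_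
  simp only [Sym2.mem_iff, exists_eq_or_imp, exists_eq_left, forall_eq_or_imp, forall_eq, h]
  by_cases h₁ : i.castSucc ∈ S₁ <;> by_cases h₂ : i.succ ∈ S₁ <;> simp [h₁, h₂]

theorem edgePay_label (σ : ℤ) (T : Finset ℕ) (v w : ℕ) :
    edgePay σ (label T v) (label T w) = if (v ∈ T ↔ w ∈ T) then -σ else σ := by
  unfold edgePay label
  by_cases h₁ : v ∈ T <;> by_cases h₂ : w ∈ T <;> simp [h₁, h₂]

theorem mem_map_valEmbedding {n : ℕ} (S : Finset (Fin n)) (v : Fin n) :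
    (v : ℕ) ∈ S.map Fin.valEmbedding ↔ v ∈ S :=
  Finset.mem_map' (f := Fin.valEmbedding)

theorem runPay_map (σ : ℤ) {m : ℕ} (S : Finset (Fin (m + 1))) :
    runPay σ (S.map Fin.valEmbedding) 2 2 0 (m + 1) =
      ∑ i : Fin m, if (i.castSucc ∈ S ↔ i.succ ∈ S) then -σ else σ := by
  have h0 : ∀ l, edgePay σ 2 l = 0 := fun l => by simp [edgePay]
  rw [runPay_succ, Finset.sum_range, h0, zero_add]
  refine Finset.sum_congr rfl fun i _ => ?_
  have h₁ := mem_map_valEmbedding S i.castSucc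
  have h₂ := mem_map_valEmbedding S i.succ
  have := edgePay_label σ (S.map Fin.valEmbedding) i (i + 1)
  simp only [Fin.val_castSucc, Fin.val_succ] at h₁ h₂
  simp only [h₁, h₂] at this
  simpa only [zero_add] using this

theorem score_eq_runPay_right {n : ℕ} (hn : n ≠ 0) {S₀ S₁ : Finset (Fin n)}
    (h : ∀ v, v ∈ S₀ ↔ v ∉ S₁) :
    score (SimpleGraph.pathGraph n) S₀ S₁ = runPay 1 (S₁.map Fin.valEmbedding) 2 2 0 n := by
  obtain ⟨m, rfl⟩ := Nat.exists_eq_succ_of_ne_zero hn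
  rw [score_pathGraph h, runPay_map]

/-- `label` gives the replier 1, although Admirable writes 0. Swapping the labels does not change
which edges have equal ends, and her payoff is minus the score. -/
theorem score_eq_runPay_left {n : ℕ} (hn : n ≠ 0) {S₀ S₁ : Finset (Fin n)}
    (h : ∀ v, v ∈ S₀ ↔ v ∉ S₁) :
    score (SimpleGraph.pathGraph n) S₀ S₁ = -runPay (-1) (S₀.map Fin.valEmbedding) 2 2 0 n := by
  obtain ⟨m, rfl⟩ := Nat.exists_eq_succ_of_ne_zero hn
  rw [score_pathGraph h, runPay_map, ← Finset.sum_neg_distrib]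
  refine Finset.sum_congr rfl fun i _ => ?_
  simp only [h, not_iff_not]
  split_ifs <;> rfl

theorem map_univ_valEmbedding (n : ℕ) :
    (Finset.univ : Finset (Fin n)).map Fin.valEmbedding = Finset.Ico 0 n := by
  rw [Fin.map_valEmbedding_univ, Nat.Iio_eq_range, Finset.range_eq_Ico]

theorem le_admirableStart {n : ℕ} (hn : n ≠ 0) {c : ℤ}
    (h : Wins (fun T => c ≤ runPay 1 T 2 2 0 n) (Finset.Ico 0 n)) :
    c ≤ admirableStart (SimpleGraph.pathGraph n) := by
  rw [← map_univ_valEmbedding] at h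
  refine (Wins.of_map Fin.valEmbedding h).le_value _ (by simp [unlabelled]) fun T _ hT => ?_
  rwa [score_eq_runPay_right hn (by simp), Finset.empty_union]

theorem admirableStart_le {n : ℕ} (hn : n ≠ 0) {c : ℤ}
    (h : Wins (fun T => -c ≤ runPay (-1) (insert 0 T) 2 2 0 n) (Finset.Ico 1 n)) :
    admirableStart (SimpleGraph.pathGraph n) ≤ c := by
  obtain ⟨m, rfl⟩ := Nat.exists_eq_succ_of_ne_zero hn
  have hm : ((Finset.univ : Finset (Fin (m + 1))).erase 0).map Fin.valEmbedding =
      Finset.Ico 1 (m + 1) := by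
    rw [Finset.map_erase, map_univ_valEmbedding]
    ext v
    simp
    omega
  rw [← hm] at h
  -- Opening at an end leaves a path, on which Impish now moves first.
  refine value_admirable_le _ (v := 0) (by simp [unlabelled]) ?_
  refine (Wins.of_map Fin.valEmbedding h).value_le _
    (by rw [unlabelled_insert_left]; simp [unlabelled]) fun T hT hP => ?_
  have h0 : (0 : Fin (m + 1)) ∉ T := fun h => by simpa using hT h
  rw [score_eq_runPay_left hn]
  · rw [insert_empty_eq, ← Finset.insert_eq, Finset.map_insert]
    simp only [Fin.valEmbedding_apply, Fin.val_zero]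
    linarith
  · intro v
    by_cases hv : v = 0 <;> simp [hv, h0]

/-- The summand 1 pays for the edge between the opening vertex and the rest. -/
theorem Guarantee.admirableStart_le {m : ℕ} {t : ℤ} (h : Guarantee (-1) 1 m t) :
    admirableStart (SimpleGraph.pathGraph (m + 1)) ≤ 1 - t := by
  unfold Guarantee at h
  rw [Nat.add_comm 1 m] at h
  refine BalanceGame.admirableStart_le (by omega) (h.mono fun T _ h => ?_)
  have h₁ := runPay_add_ge (σ := -1) (by simp) (insert 0 T) 2 2 0 1 m
  have h₂ : runPay (-1) (insert 0 T) 2 2 0 1 = 0 := by simp [runPay, edgePay]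
  have h₃ : runPay (-1) (insert 0 T) 2 2 1 m = runPay (-1) T 2 2 1 m :=
    runPay_congr _ _ fun v hv _ => by simp [show v ≠ 0 by omega]
  rw [h₂, Nat.zero_add, h₃, Nat.add_comm 1 m] at h₁
  linarith

theorem Guarantee.le_admirableStart {m : ℕ} (hm : m ≠ 0) {t : ℤ} (h : Guarantee 1 0 m t) :
    t ≤ admirableStart (SimpleGraph.pathGraph m) := by
  unfold Guarantee at h
  rw [Nat.zero_add] at h
  exact BalanceGame.le_admirableStart hm h

end BalanceGame

theorem mainTheorem7 (n : ℕ) (hn : 1 ≤ n) :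
    (Even n →
      2 * ⌊(n : ℚ) / 16⌋ + 1 ≤ BalanceGame.admirableStart (SimpleGraph.pathGraph n) ∧
      BalanceGame.admirableStart (SimpleGraph.pathGraph n) ≤ 4 * ⌈(n : ℚ) / 16⌉ + 5) ∧
    (Odd n →
      2 * ⌊(n : ℚ) / 16⌋ - 4 ≤ BalanceGame.admirableStart (SimpleGraph.pathGraph n) ∧
      BalanceGame.admirableStart (SimpleGraph.pathGraph n) ≤ 4 * ⌈(n : ℚ) / 16⌉) := by
  -- This inequality and `hC` are all that is needed about floor and ceiling.
  have hF : 16 * ⌊(n : ℚ) / 16⌋ ≤ n := by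
    have := Int.floor_le ((n : ℚ) / 16)
    rw [le_div_iff₀ (by norm_num)] at this
    rw [mul_comm]
    exact_mod_cast this
  have hC : (n : ℤ) ≤ 16 * ⌈(n : ℚ) / 16⌉ := by
    have := Int.le_ceil ((n : ℚ) / 16)
    rw [div_le_iff₀ (by norm_num)] at this
    rw [mul_comm]
    exact_mod_cast this
  generalize ⌊(n : ℚ) / 16⌋ = F at *
  generalize ⌈(n : ℚ) / 16⌉ = C at *
  constructor
  · intro hn'
    obtain ⟨k, rfl⟩ : ∃ k, n = 2 * (k + 1) := by
      obtain ⟨j, rfl⟩ := hn'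
      exact ⟨j - 1, by omega⟩
    have h₁ := (BalanceGame.guarantee_impish 0 k).le_admirableStart (by omega)
    -- After the opening an odd number `2 * k + 1` of vertices remains, so one of them is left out
    -- of the blocks.
    have h₂ := ((BalanceGame.guarantee_admirable 1 k).add_vertex (by simp)
      (by simp)).admirableStart_le
    rw [show 2 * k + 1 + 1 = 2 * (k + 1) by omega] at h₂
    constructor <;> omega
  · rintro ⟨k, rfl⟩
    have h₂ := (BalanceGame.guarantee_admirable 1 k).admirableStart_le
    refine ⟨?_, by omega⟩
    -- `guarantee_impish` covers only positive lengths, so the one-vertex path is separate.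
    obtain rfl | hk := Nat.eq_zero_or_pos k
    · have h₁ := ((BalanceGame.guarantee_zero 1 0).add_vertex (by simp)
        (by simp)).le_admirableStart (by omega)
      simp only [Nat.mul_zero] at *
      omega
    · obtain ⟨j, rfl⟩ : ∃ j, k = j + 1 := ⟨k - 1, by omega⟩
      have h₁ := ((BalanceGame.guarantee_impish 0 j).add_vertex (by simp)
        (by simp)).le_admirableStart (by omega)
      omega
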